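/- Let $M$ be a set of $n$ men and $W$ a set of $n$ women, and let $\succ$ be a preference profile: each man has a strict total order over all women and each woman has a strict total order over all men. Write $\mathrm{DA}(\succ)$ for the matching computed by the men-proposing deferred acceptance algorithm, and let $\mu=\mathrm{DA}(\succ)$. Fix a man $m$ and write his list as $\succ_m=(L,\mu(m),R)$, where $L$ is the set of women ranked above $\mu(m)$ and $R$ the set of women ranked below $\mu(m)$. Let $X\subseteq R$ and $Y\subseteq L$. Let $\succ'_m$ be a list for $m$ obtained by pushing up $X$, i.e. a list of the form $(L\cup X,\ \mu(m),\ R\setminus X)$, and let $\succ''_m$ be a list for $m$ obtained by pushing up $X$ and pushing down $Y$, i.e. a list of the form $((L\cup X)\setminus Y,\ \mu(m),\ (R\setminus X)\cup Y)$; apart from this, the order of the women above $\mu(m)$ and of the women below $\mu(m)$ is arbitrary in both lists. Let $\mu'=\mathrm{DA}(\succ_{-m},\succ'_m)$ and $\mu''=\mathrm{DA}(\succ_{-m},\succ''_m)$. Suppose that at least one of the following holds: (a) both lists place the women of $X$ in the same way, i.e. for every $x\in X$ and every woman $a\in (L\cup X)\setminus Y$ one has $a\succ'_m x$ if and only if $a\succ''_m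 x$; (b) $m$ does not incur regret by pushing up $X$, i.e. $\mu'(m)=\mu(m)$ or $\mu'(m)\succ_m\mu(m)$. Then every woman $w\in W$ weakly prefers $\mu'$ to $\mu''$: $\mu'(w)\succ_w\mu''(w)$ or $\mu'(w)=\mu''(w)$. -/

import Mathlib

namespace StableMarriage

/-- A preference list over `α`: a strict total order, where `r.prefers a b` means that
`a` is ranked strictly above `b`. -/
structure PrefList (α : Type*) where
  prefers : α → α → Prop
  strictTotal : IsStrictTotalOrder α prefers

namespace PrefList

variable {α : Type*}

/-- `a` is ranked above `b`, or `a = b`. -/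
def weaklyPrefers (r : PrefList α) (a b : α) : Prop := r.prefers a b ∨ a = b

/-- The part of the list above `a`. -/
def above (r : PrefList α) (a : α) : Set α := {b | r.prefers b a}

/-- The part of the list below `a`. -/
def below (r : PrefList α) (a : α) : Set α := {b | r.prefers a b}

/-- `a` is the favourite element of `s`. -/
def IsFavourite (r : PrefList α) (s : Set α) (a : α) : Prop :=
  a ∈ s ∧ ∀ b ∈ s, r.weaklyPrefers a b

theorem irrefl (r : PrefList α) (a : α) : ¬ r.prefers a a :=
  r.strictTotal.irrefl a

theorem trans (r : PrefList α) {a b c : α} (h : r.prefers a b) (h' : r.prefers b c) :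
    r.prefers a c :=
  r.strictTotal.trans a b c h h'

theorem asymm (r : PrefList α) {a b : α} (h : r.prefers a b) : ¬ r.prefers b a :=
  fun h' => r.irrefl a (r.trans h h')

theorem total (r : PrefList α) (a b : α) : r.prefers a b ∨ a = b ∨ r.prefers b a := by
  by_contra! h
  exact h.2.1 (r.strictTotal.trichotomous a b h.1 h.2.2)

theorem IsFavourite.unique {r : PrefList α} {s : Set α} {a b : α}
    (ha : r.IsFavourite s a) (hb : r.IsFavourite s b) : a = b := by
  rcases ha.2 b hb.1 with h | h
  · rcases hb.2 a ha.1 with h' | h'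
    · exact absurd h' (r.asymm h)
    · exact h'.symm
  · exact h

theorem exists_isFavourite [Finite α] (r : PrefList α) {s : Set α} (hs : s.Nonempty) :
    ∃ a, r.IsFavourite s a := by
  have := r.strictTotal
  have wf : WellFounded r.prefers := Finite.wellFounded_of_trans_of_irrefl _
  obtain ⟨a, ha, hmin⟩ := wf.has_min s hs
  refine ⟨a, ha, fun b hb => ?_⟩
  rcases r.total a b with h | h | h
  · exact Or.inl h
  · exact Or.inr h
  · exact absurd h (hmin b hb)

end PrefList

/-- A preference profile: every man ranks all women and every woman ranks all men. -/
structure Profile (M W : Type*) where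
  men : M → PrefList W
  women : W → PrefList M

namespace Profile

variable {M W : Type*}

open Classical in
/-- The profile obtained when man `m` reports the list `r` and nobody else changes. -/
noncomputable def replaceMan (P : Profile M W) (m : M) (r : PrefList W) : Profile M W where
  men := Function.update P.men m r
  women := P.women

/-- `R` is the set of pairs `(m, w)` such that `w` has rejected `m` so far. In the proposal phase
the standing proposal of `m` is to his favourite woman among those who have not rejected him yet.
(A man who is tentatively accepted simply keeps his standing proposal.) -/
def Proposes (P : Profile M W) (R : Finset (M × W)) (m : M) (w : W) : Prop :=
  (P.men m).IsFavourite {w' | (m, w') ∉ R} w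

/-- In the rejection phase every woman keeps her favourite standing proposal and
rejects the others: `w` rejects `m`. -/
def Rejects (P : Profile M W) (R : Finset (M × W)) (m : M) (w : W) : Prop :=
  P.Proposes R m w ∧ ∃ m', P.Proposes R m' w ∧ (P.women w).prefers m' m

/-- All women weakly prefer `μ` to `μ'`.
A matching is a bijection `M ≃ W`. -/
def WomenWeaklyPrefer (P : Profile M W) (μ μ' : M ≃ W) : Prop :=
  ∀ w, (P.women w).weaklyPrefers (μ.symm w) (μ'.symm w)

variable [Fintype M] [Fintype W]

open Classical in
/-- One round of deferred acceptance: a proposal phase followed by a rejection phase. -/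
noncomputable def daRound (P : Profile M W) (R : Finset (M × W)) : Finset (M × W) :=
  R ∪ Finset.univ.filter fun p => P.Rejects R p.1 p.2

/-- The rejections made in the first `k` rounds. -/
noncomputable def daState (P : Profile M W) (k : ℕ) : Finset (M × W) :=
  P.daRound^[k] ∅

/-- The rejections at termination. Every round but the last makes a new rejection, so
`|M| * |W|` rounds suffice; see `daRound_daFinal`. -/
noncomputable def daFinal (P : Profile M W) : Finset (M × W) :=
  P.daState (Fintype.card (M × W))

theorem mem_daRound {P : Profile M W} {R : Finset (M × W)} {m : M} {w : W} :
    (m, w) ∈ P.daRound R ↔ (m, w) ∈ R ∨ P.Rejects R m w := by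
  simp [daRound]

theorem daState_succ (P : Profile M W) (k : ℕ) :
    P.daState (k + 1) = P.daRound (P.daState k) := by
  simp only [daState, Function.iterate_succ_apply']

/-- No further rejection, hence no further proposal, is made after `daFinal`. -/
theorem daRound_daFinal (P : Profile M W) : P.daRound P.daFinal = P.daFinal := by
  have key : ∀ k, P.daRound (P.daState k) = P.daState k ∨ k + 1 ≤ (P.daState (k + 1)).card := by
    intro k
    induction k with
    | zero =>
      by_cases h : P.daRound (P.daState 0) = P.daState 0
      · exact Or.inl h
      · right
        have : (P.daState 1).Nonempty := by
          rw [Finset.nonempty_iff_ne_empty]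
          intro h0
          apply h
          rw [← daState_succ, h0]
          rfl
        simpa using this.card_pos
    | succ k ih =>
      by_cases h : P.daRound (P.daState (k + 1)) = P.daState (k + 1)
      · exact Or.inl h
      · right
        rcases ih with ih | ih
        · exact absurd (by rw [daState_succ, ih, ih]) h
        · have hsub : P.daState (k + 1) ⊂ P.daState (k + 1 + 1) := by
            rw [daState_succ P (k + 1)]
            exact Finset.ssubset_iff_subset_ne.2
              ⟨by classical exact Finset.subset_union_left, fun h' => h h'.symm⟩
          have := Finset.card_lt_card hsub
          omega
  rcases key (Fintype.card (M × W)) with h | h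
  · exact h
  · have := Finset.card_le_univ (P.daState (Fintype.card (M × W) + 1))
    omega

/-- A woman who has rejected a man has a standing proposal from a man whom she prefers. -/
theorem exists_proposes_of_mem (P : Profile M W) (k : ℕ) :
    ∀ m w, (m, w) ∈ P.daState k →
      ∃ m', P.Proposes (P.daState k) m' w ∧ (P.women w).prefers m' m := by
  induction k with
  | zero => intro m w h; simp [daState] at h
  | succ k ih =>
    intro m w h
    obtain ⟨m', hm', hlt⟩ : ∃ m', P.Proposes (P.daState k) m' w ∧ (P.women w).prefers m' m := by
      rw [daState_succ, mem_daRound] at h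
      rcases h with h | h
      · exact ih m w h
      · exact h.2
    obtain ⟨b, hb, hbest⟩ := (P.women w).exists_isFavourite
      (s := {m' | P.Proposes (P.daState k) m' w}) ⟨m', hm'⟩
    refine ⟨b, ⟨?_, ?_⟩, ?_⟩
    · change (b, w) ∉ _
      rw [daState_succ, mem_daRound]
      rintro (h' | ⟨-, c, hc, hcb⟩)
      · exact hb.1 h'
      · rcases hbest c hc with h'' | h''
        · exact (P.women w).asymm hcb h''
        · exact (P.women w).irrefl c (h'' ▸ hcb)
    · intro w' hw'
      refine hb.2 w' fun h' => hw' ?_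
      rw [daState_succ, mem_daRound]
      exact Or.inl h'
    · rcases hbest m' hm' with h' | h'
      · exact (P.women w).trans h' hlt
      · exact h' ▸ hlt

theorem exists_proposes (P : Profile M W) (hcard : Fintype.card M = Fintype.card W) (m : M) :
    ∃ w, P.Proposes P.daFinal m w := by
  apply PrefList.exists_isFavourite
  by_contra hne
  have hall : ∀ w, (m, w) ∈ P.daFinal := by
    intro w
    by_contra h
    exact hne ⟨w, h⟩
  choose f hf using fun w => exists_proposes_of_mem P _ m w (hall w)
  have hinj : Function.Injective f := by
    intro w w' h
    have h1 := (hf w).1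
    rw [h] at h1
    exact h1.unique (hf w').1
  have hsurj := ((Fintype.bijective_iff_injective_and_card f).2 ⟨hinj, hcard.symm⟩).2
  obtain ⟨w, rfl⟩ := hsurj m
  exact (P.women w).irrefl _ (hf w).2

/-- The woman to whom `m` stands proposed when deferred acceptance terminates. -/
noncomputable def daPartner (P : Profile M W) (hcard : Fintype.card M = Fintype.card W) (m : M) :
    W :=
  (P.exists_proposes hcard m).choose

theorem daPartner_injective (P : Profile M W) (hcard : Fintype.card M = Fintype.card W) :
    Function.Injective (P.daPartner hcard) := by
  have hp : ∀ m, P.Proposes P.daFinal m (P.daPartner hcard m) :=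
    fun m => (P.exists_proposes hcard m).choose_spec
  have key : ∀ m m', P.daPartner hcard m = P.daPartner hcard m' →
      ¬ (P.women (P.daPartner hcard m)).prefers m' m := by
    intro m m' h hlt
    have hmem : (m, P.daPartner hcard m) ∈ P.daRound P.daFinal :=
      mem_daRound.2 (Or.inr ⟨hp m, m', h ▸ hp m', hlt⟩)
    rw [daRound_daFinal] at hmem
    exact (hp m).1 hmem
  intro m m' h
  rcases (P.women (P.daPartner hcard m)).total m m' with h' | h' | h'
  · exact absurd (h ▸ h') (key m' m h.symm)
  · exact h'
  · exact absurd h' (key m m' h)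

/-- The matching `DA(P)` computed by the men-proposing deferred acceptance algorithm. A matching
between equally many men and women is a bijection `μ : M ≃ W`; the partner of a
woman `w` is `μ.symm w`. -/
noncomputable def DA (P : Profile M W) (hcard : Fintype.card M = Fintype.card W) : M ≃ W :=
  Equiv.ofBijective (P.daPartner hcard)
    ((Fintype.bijective_iff_injective_and_card _).2 ⟨P.daPartner_injective hcard, hcard⟩)

end Profile

section Push

variable {W : Type*}

/-- `r'` results from the list `r = (L, p, R)` by pushing up the set `X`:
it has the form `(L ∪ X, p, R \ X)`. -/
def IsPushUp (r : PrefList W) (p : W) (X : Set W) (r' : PrefList W) : Prop :=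
  r'.above p = r.above p ∪ X ∧ r'.below p = r.below p \ X

/-- `r''` results from the list `r = (L, p, R)` by pushing up the set `X` and pushing down the
set `Y`: it has the form `((L ∪ X) \ Y, p, (R \ X) ∪ Y)`. -/
def IsPushUpDown (r : PrefList W) (p : W) (X Y : Set W) (r'' : PrefList W) : Prop :=
  r''.above p = (r.above p ∪ X) \ Y ∧ r''.below p = (r.below p \ X) ∪ Y

/-- The lists `r'` and `r''` place the women of `X` in the same way: every `x ∈ X` is ranked in
the same way in both lists relative to all women who are above `p` in both lists. -/
def SamePlacement (p : W) (X : Set W) (r' r'' : PrefList W) : Prop :=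
  ∀ x ∈ X, ∀ a ∈ r'.above p ∩ r''.above p, r'.prefers a x ↔ r''.prefers a x

end Push

end StableMarriage

/-! Deferred acceptance gives every man his best stable partner, hence every woman her worst one.
The matching `μ'` is stable for the list `r'` of `m`, and it stays stable for `r''` as soon as no
woman ranked above `μ' m` by `r''` is ranked below `μ' m` by `r'`; when it does, every woman weakly
prefers `μ'` to `μ''`.

To locate `μ' m` we use that misreporting never helps a man, once with the true list `P.men m` and
once with `r'` in its place. Thus `μ' m` is weakly below `μ m` in `P.men m` and weakly above it in
`r'`, so it is `μ m` or a woman of `X`, and it is `μ m` if there is no regret.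

That misreporting never helps is the blocking lemma of Gale and Sotomayor: if some men prefer a
matching `ν` to `μ`, then `ν` has a blocking pair whose man is not among them. -/

namespace StableMarriage

namespace PrefList

variable {α : Type*} {r : PrefList α} {a b c : α}

theorem not_prefers : ¬ r.prefers b a ↔ r.weaklyPrefers a b := by
  refine ⟨fun h => ?_, ?_⟩
  · rcases r.total a b with h' | h' | h'
    · exact Or.inl h'
    · exact Or.inr h'
    · exact absurd h' h
  · rintro (h | rfl)
    · exact r.asymm h
    · exact r.irrefl a

theorem ne_of_prefers (h : r.prefers a b) : a ≠ b := by
  rintro rfl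
  exact r.irrefl a h

theorem prefers_of_weaklyPrefers_of_prefers (h : r.weaklyPrefers a b) (h' : r.prefers b c) :
    r.prefers a c := by
  rcases h with h | rfl
  · exact r.trans h h'
  · exact h'

theorem weaklyPrefers_trans (h : r.weaklyPrefers a b) (h' : r.weaklyPrefers b c) :
    r.weaklyPrefers a c := by
  rcases h' with h' | rfl
  · exact Or.inl (prefers_of_weaklyPrefers_of_prefers h h')
  · exact h

theorem weaklyPrefers_antisymm (h : r.weaklyPrefers a b) (h' : r.weaklyPrefers b a) : a = b :=
  h.resolve_left (not_prefers.2 h')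

end PrefList

open PrefList

section Push

variable {W : Type*} {r r' r'' : PrefList W} {p : W} {X Y : Set W}

theorem IsPushUp.above_subset_above (h' : IsPushUp r p X r') (h'' : IsPushUpDown r p X Y r'') :
    r''.above p ⊆ r'.above p := by
  rw [h'.1, h''.1]
  exact Set.sdiff_subset

theorem SamePlacement.above_subset_above (h : SamePlacement p X r' r'')
    (h' : IsPushUp r p X r') (h'' : IsPushUpDown r p X Y r'') {x : W} (hx : x ∈ X \ Y) :
    r''.above x ⊆ r'.above x := by
  intro a hax
  have hxp : x ∈ r''.above p := by
    rw [h''.1]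
    exact ⟨Or.inr hx.1, hx.2⟩
  have hap : a ∈ r''.above p := r''.trans hax hxp
  exact (h x hx.1 a ⟨h'.above_subset_above h'' hap, hap⟩).2 hax

end Push

namespace Profile

variable {M W : Type*}

section Replace

variable (P : Profile M W) (m : M) (r r' : PrefList W)

@[simp]
theorem replaceMan_men_self : (P.replaceMan m r).men m = r := by
  simp [replaceMan]

theorem replaceMan_men_of_ne {a : M} (h : a ≠ m) : (P.replaceMan m r).men a = P.men a := by
  simp [replaceMan, h]

@[simp]
theorem replaceMan_eq_self : P.replaceMan m (P.men m) = P := by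
  simp [replaceMan]

@[simp]
theorem replaceMan_replaceMan : (P.replaceMan m r).replaceMan m r' = P.replaceMan m r' := by
  simp [replaceMan]

end Replace

section Stable

/-- `(m, w)` is a blocking pair of the matching `ν`: both prefer each other to their partners. -/
def Blocks (P : Profile M W) (ν : M ≃ W) (m : M) (w : W) : Prop :=
  (P.men m).prefers w (ν m) ∧ (P.women w).prefers m (ν.symm w)

/-- A matching is stable if it has no blocking pair. -/
def Stable (P : Profile M W) (ν : M ≃ W) : Prop :=
  ∀ m w, ¬ P.Blocks ν m w

/-- The men who strictly prefer the matching `ν` to the matching `μ`. -/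
def menPreferring (P : Profile M W) (ν μ : M ≃ W) : Set M :=
  {m | (P.men m).prefers (ν m) (μ m)}

variable {P : Profile M W} {μ ν : M ≃ W}

theorem blocks_of_prefers {m : M} {w : W} (hm : (P.men m).weaklyPrefers w (ν m))
    (hw : (P.women w).prefers m (ν.symm w)) : P.Blocks ν m w := by
  refine ⟨hm.resolve_right fun h => ?_, hw⟩
  exact ne_of_prefers hw (by rw [h, Equiv.symm_apply_apply])

theorem Stable.prefers_symm (hμ : P.Stable μ) {m : M} {w : W}
    (h : (P.men m).prefers w (μ m)) : (P.women w).prefers (μ.symm w) m := by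
  have hle : (P.women w).weaklyPrefers (μ.symm w) m := not_prefers.1 fun hw => hμ m w ⟨h, hw⟩
  refine hle.resolve_right fun heq => ?_
  exact ne_of_prefers h (by rw [← heq, Equiv.apply_symm_apply])

theorem Stable.womenWeaklyPrefer (hν : P.Stable ν)
    (h : ∀ m, (P.men m).weaklyPrefers (μ m) (ν m)) : P.WomenWeaklyPrefer ν μ := by
  refine fun w => not_prefers.1 fun hlt => hν (μ.symm w) w (blocks_of_prefers ?_ hlt)
  simpa using h (μ.symm w)

theorem Stable.replaceMan (hν : P.Stable ν) {m : M} {r : PrefList W}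
    (hr : r.above (ν m) ⊆ (P.men m).above (ν m)) : (P.replaceMan m r).Stable ν := by
  rintro a w ⟨hw, ha⟩
  refine hν a w ⟨?_, ha⟩
  obtain rfl | hne := eq_or_ne a m
  · rw [replaceMan_men_self] at hw
    exact hr hw
  · rwa [replaceMan_men_of_ne P m r hne] at hw

theorem Stable.blocks_symm_of_notMem (hμ : P.Stable μ) {s : M} (hs : s ∈ P.menPreferring ν μ)
    (hns : μ.symm (ν s) ∉ P.menPreferring ν μ) : P.Blocks ν (μ.symm (ν s)) (ν s) := by
  refine blocks_of_prefers ?_ ?_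
  · simpa using not_prefers.1 hns
  · simpa using hμ.prefers_symm hs

end Stable

section DeferredAcceptance

theorem Proposes.mono {P : Profile M W} {R R' : Finset (M × W)} {m : M} {w : W}
    (h : P.Proposes R m w) (hR : R ⊆ R') (hw : (m, w) ∉ R') : P.Proposes R' m w :=
  ⟨hw, fun w' hw' => h.2 w' fun hmem => hw' (hR hmem)⟩

variable [Fintype M] [Fintype W]

theorem Proposes.exists_notMem_daRound {P : Profile M W} {R : Finset (M × W)} {a : M} {w : W}
    (h : P.Proposes R a w) :
    ∃ b, P.Proposes R b w ∧ (b, w) ∉ P.daRound R ∧ (P.women w).weaklyPrefers b a := by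
  obtain ⟨b, hb, hbest⟩ := (P.women w).exists_isFavourite (s := {c | P.Proposes R c w}) ⟨a, h⟩
  refine ⟨b, hb, fun hmem => ?_, hbest a h⟩
  rcases mem_daRound.1 hmem with hmem | ⟨-, c, hc, hcb⟩
  · exact hb.1 hmem
  · exact not_prefers.2 (hbest c hc) hcb

variable (P : Profile M W)

theorem daState_mono : Monotone P.daState := by
  refine monotone_nat_of_le_succ fun k p hp => ?_
  rw [daState_succ]
  exact mem_daRound.2 (Or.inl hp)

theorem rejects_of_notMem_of_mem_succ {k : ℕ} {m : M} {w : W} (h : (m, w) ∉ P.daState k)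
    (h' : (m, w) ∈ P.daState (k + 1)) : P.Rejects (P.daState k) m w := by
  rw [daState_succ, mem_daRound] at h'
  exact h'.resolve_left h

theorem exists_proposes_of_mem_succ {k : ℕ} {a : M} {w : W} (h : (a, w) ∈ P.daState (k + 1)) :
    ∃ b, P.Proposes (P.daState k) b w ∧ (b, w) ∉ P.daState (k + 1) ∧
      (P.women w).prefers b a := by
  obtain ⟨c, hc, hca⟩ : ∃ c, P.Proposes (P.daState k) c w ∧ (P.women w).prefers c a := by
    by_cases hk : (a, w) ∈ P.daState k
    · exact P.exists_proposes_of_mem k a w hk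
    · exact (P.rejects_of_notMem_of_mem_succ hk h).2
  obtain ⟨b, hb, hkept, hbc⟩ := hc.exists_notMem_daRound
  rw [← daState_succ] at hkept
  exact ⟨b, hb, hkept, prefers_of_weaklyPrefers_of_prefers hbc hca⟩

theorem exists_last_rejection {A : Set (M × W)} {k : ℕ} (h : ∃ p ∈ A, p ∈ P.daState k) :
    ∃ j < k, (∃ p ∈ A, p ∉ P.daState j ∧ p ∈ P.daState (j + 1)) ∧
      ∀ p ∈ A, p ∈ P.daState k → p ∈ P.daState (j + 1) := by
  induction k with
  | zero => simp [daState] at h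
  | succ k ih =>
    by_cases hnew : ∃ p ∈ A, p ∉ P.daState k ∧ p ∈ P.daState (k + 1)
    · exact ⟨k, k.lt_succ_self, hnew, fun _ _ hp => hp⟩
    · push Not at hnew
      have hold : ∀ p ∈ A, p ∈ P.daState (k + 1) → p ∈ P.daState k :=
        fun p hpA hp => by_contra fun hpk => hnew p hpA hpk hp
      obtain ⟨p, hpA, hp⟩ := h
      obtain ⟨j, hjk, hex, hlast⟩ := ih ⟨p, hpA, hold p hpA hp⟩
      exact ⟨j, hjk.trans k.lt_succ_self, hex, fun q hqA hq => hlast q hqA (hold q hqA hq)⟩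

variable (hcard : Fintype.card M = Fintype.card W)

theorem proposes_DA (m : M) : P.Proposes P.daFinal m (P.DA hcard m) :=
  (P.exists_proposes hcard m).choose_spec

theorem mem_daFinal_of_prefers_DA {m : M} {w : W} (h : (P.men m).prefers w (P.DA hcard m)) :
    (m, w) ∈ P.daFinal :=
  by_contra fun hw => not_prefers.2 ((P.proposes_DA hcard m).2 w hw) h

theorem stable_DA : P.Stable (P.DA hcard) := by
  rintro m w ⟨hw, hm⟩
  obtain ⟨a, ha, ham⟩ := P.exists_proposes_of_mem _ m w (P.mem_daFinal_of_prefers_DA hcard hw)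
  obtain rfl : P.DA hcard a = w := (P.proposes_DA hcard a).unique ha
  rw [Equiv.symm_apply_apply] at hm
  exact (P.women _).asymm ham hm

variable {P} in
theorem Stable.notMem_daState {ν : M ≃ W} (hν : P.Stable ν) (k : ℕ) (m : M) :
    (m, ν m) ∉ P.daState k := by
  induction k generalizing m with
  | zero => simp [daState]
  | succ k ih =>
    intro hmem
    obtain ⟨-, a, ha, ham⟩ := P.rejects_of_notMem_of_mem_succ (ih m) hmem
    exact hν a (ν m) (blocks_of_prefers (ha.2 _ (ih a)) (by simpa using ham))

variable {P} in
theorem Stable.weaklyPrefers_DA {ν : M ≃ W} (hν : P.Stable ν) (m : M) :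
    (P.men m).weaklyPrefers (P.DA hcard m) (ν m) :=
  (P.proposes_DA hcard m).2 _ (hν.notMem_daState _ m)

theorem exists_blocks_of_mapsTo {ν : M ≃ W} (hne : (P.menPreferring ν (P.DA hcard)).Nonempty)
    (hmaps : Set.MapsTo (fun s => ν.symm (P.DA hcard s))
      (P.menPreferring ν (P.DA hcard)) (P.menPreferring ν (P.DA hcard))) :
    ∃ b ∉ P.menPreferring ν (P.DA hcard), ∃ w, P.Blocks ν b w := by
  set μ := P.DA hcard
  set S := P.menPreferring ν μ
  have hrejected : ∀ s ∈ S, (s, ν s) ∈ P.daFinal := fun s => P.mem_daFinal_of_prefers_DA hcard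
  obtain ⟨t, ht⟩ := hne
  obtain ⟨j, hj, ⟨⟨s, w₀⟩, hs, hnew, hmem⟩, hlast⟩ :=
    P.exists_last_rejection (A := {p | p.1 ∈ S}) ⟨(t, ν t), ht, hrejected t ht⟩
  -- No man of `S` is rejected after `s`, so by then `μ s` has rejected her `ν`-partner. The man `b`
  -- whom she keeps in the round rejecting `s` is displaced later, hence outside `S`.
  have hpartner : (ν.symm (μ s), μ s) ∈ P.daFinal := by
    simpa using hrejected _ (hmaps hs)
  obtain ⟨b, hb, hkept, hbetter⟩ := P.exists_proposes_of_mem_succ (hlast _ (hmaps hs) hpartner)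
  have hbS : b ∉ S := by
    intro hbS
    have hfinal : P.Proposes P.daFinal b (μ s) :=
      hb.mono (P.daState_mono hj.le) fun h => hkept (hlast _ hbS h)
    obtain rfl : b = s := μ.injective ((P.proposes_DA hcard b).unique hfinal)
    have hw₀ : w₀ = μ b := (P.rejects_of_notMem_of_mem_succ hnew hmem).1.unique hb
    exact hkept (hw₀ ▸ hmem)
  have hbμ : (P.men b).weaklyPrefers (μ s) (μ b) :=
    hb.2 _ ((P.stable_DA hcard).notMem_daState j b)
  exact ⟨b, hbS, μ s, blocks_of_prefers (weaklyPrefers_trans hbμ (not_prefers.1 hbS)) hbetter⟩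

theorem exists_blocks_notMem_menPreferring {ν : M ≃ W}
    (hne : (P.menPreferring ν (P.DA hcard)).Nonempty) :
    ∃ b ∉ P.menPreferring ν (P.DA hcard), ∃ w, P.Blocks ν b w := by
  set μ := P.DA hcard
  set S := P.menPreferring ν μ
  by_cases hmaps : Set.MapsTo (ν.trans μ.symm) S S
  · exact P.exists_blocks_of_mapsTo hcard hne
      (Equiv.Perm.perm_symm_mapsTo_of_mapsTo (ν.trans μ.symm) hmaps)
  · obtain ⟨s, hs, hns⟩ : ∃ s ∈ S, μ.symm (ν s) ∉ S := by
      simpa [Set.MapsTo] using hmaps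
    exact ⟨μ.symm (ν s), hns, ν s, (P.stable_DA hcard).blocks_symm_of_notMem hs hns⟩

theorem weaklyPrefers_DA_replaceMan (m : M) (r : PrefList W) :
    (P.men m).weaklyPrefers (P.DA hcard m) ((P.replaceMan m r).DA hcard m) := by
  refine not_prefers.1 fun hgain => ?_
  obtain ⟨b, hb, w, hw, hbw⟩ := P.exists_blocks_notMem_menPreferring hcard ⟨m, hgain⟩
  have hbm : b ≠ m := by
    rintro rfl
    exact hb hgain
  refine (P.replaceMan m r).stable_DA hcard b w ⟨?_, hbw⟩
  rwa [replaceMan_men_of_ne P m r hbm]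

theorem DA_replaceMan_weaklyPrefers_DA (m : M) (r : PrefList W) :
    r.weaklyPrefers ((P.replaceMan m r).DA hcard m) (P.DA hcard m) := by
  simpa using (P.replaceMan m r).weaklyPrefers_DA_replaceMan hcard m (P.men m)

theorem DA_replaceMan_eq_or_mem_of_isPushUp {m : M} {X : Set W} {r : PrefList W}
    (hr : IsPushUp (P.men m) (P.DA hcard m) X r) :
    (P.replaceMan m r).DA hcard m = P.DA hcard m ∨ (P.replaceMan m r).DA hcard m ∈ X := by
  rcases P.DA_replaceMan_weaklyPrefers_DA hcard m r with h | h
  · have hmem : (P.replaceMan m r).DA hcard m ∈ (P.men m).above (P.DA hcard m) ∪ X := by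
      rw [← hr.1]
      exact h
    exact Or.inr (hmem.resolve_left (not_prefers.2 (P.weaklyPrefers_DA_replaceMan hcard m r)))
  · exact Or.inl h

theorem womenWeaklyPrefer_DA_replaceMan {m : M} {r r' : PrefList W}
    (h : r'.above ((P.replaceMan m r).DA hcard m) ⊆ r.above ((P.replaceMan m r).DA hcard m)) :
    P.WomenWeaklyPrefer ((P.replaceMan m r).DA hcard) ((P.replaceMan m r').DA hcard) := by
  have hstable : (P.replaceMan m r').Stable ((P.replaceMan m r).DA hcard) := by
    rw [← replaceMan_replaceMan P m r r']
    exact ((P.replaceMan m r).stable_DA hcard).replaceMan (by rwa [replaceMan_men_self])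
  exact hstable.womenWeaklyPrefer (hstable.weaklyPrefers_DA hcard)

end DeferredAcceptance

end Profile

end StableMarriage

theorem mainTheorem10 {M W : Type*} [Fintype M] [Fintype W]
    (hcard : Fintype.card M = Fintype.card W)
    (P : StableMarriage.Profile M W) (m : M) (X Y : Set W)
    (hX : X ⊆ (P.men m).below (P.DA hcard m))
    (hY : Y ⊆ (P.men m).above (P.DA hcard m))
    (r' r'' : StableMarriage.PrefList W)
    (hr' : StableMarriage.IsPushUp (P.men m) (P.DA hcard m) X r')
    (hr'' : StableMarriage.IsPushUpDown (P.men m) (P.DA hcard m) X Y r'') :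
    (StableMarriage.SamePlacement (P.DA hcard m) X r' r'' →
      P.WomenWeaklyPrefer ((P.replaceMan m r').DA hcard) ((P.replaceMan m r'').DA hcard)) ∧
    ((P.men m).weaklyPrefers ((P.replaceMan m r').DA hcard m) (P.DA hcard m) →
      P.WomenWeaklyPrefer ((P.replaceMan m r').DA hcard) ((P.replaceMan m r'').DA hcard)) := by
  have hle := P.weaklyPrefers_DA_replaceMan hcard m r'
  have of_eq (h : (P.replaceMan m r').DA hcard m = P.DA hcard m) :
      P.WomenWeaklyPrefer ((P.replaceMan m r').DA hcard) ((P.replaceMan m r'').DA hcard) :=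
    P.womenWeaklyPrefer_DA_replaceMan hcard (h ▸ hr'.above_subset_above hr'')
  refine ⟨fun hplace => ?_, fun hregret => ?_⟩
  · rcases P.DA_replaceMan_eq_or_mem_of_isPushUp hcard hr' with h | hmemX
    · exact of_eq h
    · have hnotMemY : (P.replaceMan m r').DA hcard m ∉ Y := fun hmemY =>
        (P.men m).asymm (hX hmemX) (hY hmemY)
      exact P.womenWeaklyPrefer_DA_replaceMan hcard
        (hplace.above_subset_above hr' hr'' ⟨hmemX, hnotMemY⟩)
  · exact of_eq (StableMarriage.PrefList.weaklyPrefers_antisymm hregret hle)
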